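/- Let $X$ be a complex Banach space with open unit ball $B$, and let $\bar B^{**}$ be the closed unit ball of its bidual $X^{**}$. Let $H^\infty(B)$ be the algebra of bounded holomorphic functions on $B$ with the supremum norm, and $A_u(B)\subset H^\infty(B)$ the subalgebra of uniformly continuous holomorphic functions on $B$. Let $H(B)$ be a uniform algebra with $A_u(B)\subset H(B)\subset H^\infty(B)$, i.e. a subalgebra that is closed for the supremum norm. Let $M_{H(B)}$ be its spectrum (the set of nonzero multiplicative linear functionals, with the weak-star topology), and let $\hat f$ be the Gelfand transform of $f\in H(B)$. Each $x\in B$ is identified with the evaluation $\delta_x\in M_{H(B)}$. Let $P(X)$ be the space of continuous polynomials on $X$, and for $P\in P(X)$ let $\tilde P$ be its Aron–Berner extension to $X^{**}$. For $g\in A_u(B)$, let $\tilde g$ be its Aron–Berner extension: on the open unit ball of $X^{**}$ it is the sum of the Aron–Berner extensions of the Taylor polynomials of $g$ at $0$, and it is extended continuously to $\bar B^{**}$. For $x_0^{**}\in\bar B^{**}$ and $f\in H(B)$ put $$Cl_B^{\mathcal P}(f,x_0^{**})=\{\lambda\in\mathbb C:\ \exists \text{ a net } (x_\alpha)\subset B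 \text{ with } P(x_\alpha)\to\tilde P(x_0^{**}) \text{ for all } P\in P(X) \text{ and } f(x_\alpha)\to\lambda\},$$ $$M_{x_0^{**}}^{\mathcal P}=\{\tau\in M_{H(B)}:\ \tau(g)=\tilde g(x_0^{**}) \text{ for all } g\in A_u(B)\}.$$ If $B$ is dense in $M_{H(B)}$, then for every $x_0^{**}\in\bar B^{**}$ and every $f\in H(B)$, $$Cl_B^{\mathcal P}(f,x_0^{**})=\hat f\big(M_{x_0^{**}}^{\mathcal P}\big).$$ -/

import Mathlib

open Filter Topology
open scoped BoundedContinuousFunction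

namespace PolyCluster

/-- The open unit ball `B` of `X`. -/
abbrev UnitBall (X : Type*) [NormedAddCommGroup X] : Type _ :=
  {x : X // x ∈ Metric.ball (0 : X) 1}

/-- The bidual `X**`, with its norm. -/
abbrev Bidual (X : Type*) [NormedAddCommGroup X] [NormedSpace ℂ X] : Type _ :=
  StrongDual ℂ (StrongDual ℂ X)

section Algebras

variable {X : Type*} [NormedAddCommGroup X] [NormedSpace ℂ X]

/-- A function on `B`, regarded as a function on `X` (by `0` outside `B`), so that derivatives of it
at points of the open set `B` can be taken. -/
noncomputable def zeroExt (f : UnitBall X → ℂ) : X → ℂ :=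
  Function.extend Subtype.val f 0

set_option linter.unusedSectionVars false in
theorem zeroExt_apply (f : UnitBall X → ℂ) (x : UnitBall X) : zeroExt f (x : X) = f x :=
  Subtype.val_injective.extend_apply f 0 x

/-- `f : B → ℂ` is holomorphic: around each point of `B` it is the sum of a power series whose
terms are continuous homogeneous polynomials. -/
def IsHolo (f : UnitBall X → ℂ) : Prop :=
  AnalyticOnNhd ℂ (zeroExt f) (Metric.ball (0 : X) 1)

theorem isHolo_of_eq {f : UnitBall X → ℂ} {F : X → ℂ}
    (hF : AnalyticOnNhd ℂ F (Metric.ball (0 : X) 1)) (h : ∀ x : UnitBall X, F x = f x) :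
    IsHolo f :=
  hF.congr Metric.isOpen_ball fun x hx => by
    rw [h ⟨x, hx⟩, ← zeroExt_apply f ⟨x, hx⟩]

variable (X)

/-- `H^∞(B)`: the bounded holomorphic functions on `B`, inside the Banach algebra of bounded
continuous functions on `B` with the supremum norm. -/
noncomputable def Hinf : Subalgebra ℂ (UnitBall X →ᵇ ℂ) where
  carrier := {f | IsHolo (f : UnitBall X → ℂ)}
  mul_mem' {f g} hf hg := isHolo_of_eq (AnalyticOnNhd.mul hf hg) fun x => by
    simp [zeroExt_apply]
  add_mem' {f g} hf hg := isHolo_of_eq (AnalyticOnNhd.add hf hg) fun x => by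
    simp [zeroExt_apply]
  algebraMap_mem' c := isHolo_of_eq (F := fun _ => c) analyticOnNhd_const fun x => by
    simp

/-- `A_u(B)`: the uniformly continuous holomorphic functions on `B` (such functions are bounded). -/
noncomputable def Au : Subalgebra ℂ (UnitBall X →ᵇ ℂ) where
  carrier := {f | f ∈ Hinf X ∧ UniformContinuous (f : UnitBall X → ℂ)}
  mul_mem' {f g} hf hg := by
    refine ⟨mul_mem hf.1 hg.1, ?_⟩
    have h := hf.2
    have h' := hg.2
    rw [Metric.uniformContinuous_iff] at h h' ⊢
    intro ε hε
    have hC : 0 < ‖f‖ + ‖g‖ + 1 := by positivity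
    obtain ⟨a, ha, h⟩ := h (ε / (‖f‖ + ‖g‖ + 1)) (by positivity)
    obtain ⟨b, hb, h'⟩ := h' (ε / (‖f‖ + ‖g‖ + 1)) (by positivity)
    refine ⟨min a b, lt_min ha hb, fun {x y} hxy => ?_⟩
    have h1 := h (hxy.trans_le (min_le_left a b))
    have h2 := h' (hxy.trans_le (min_le_right a b))
    rw [dist_eq_norm] at h1 h2 ⊢
    have e : (f * g) x - (f * g) y = f x * (g x - g y) + (f x - f y) * g y := by
      simp only [BoundedContinuousFunction.mul_apply]; ring
    rw [e]
    calc ‖f x * (g x - g y) + (f x - f y) * g y‖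
        ≤ ‖f x‖ * ‖g x - g y‖ + ‖f x - f y‖ * ‖g y‖ := by
          refine (norm_add_le _ _).trans ?_
          rw [norm_mul, norm_mul]
      _ ≤ ‖f‖ * (ε / (‖f‖ + ‖g‖ + 1)) + (ε / (‖f‖ + ‖g‖ + 1)) * ‖g‖ := by
          gcongr
          · exact f.norm_coe_le_norm x
          · exact g.norm_coe_le_norm y
      _ < (‖f‖ + ‖g‖ + 1) * (ε / (‖f‖ + ‖g‖ + 1)) := by
          have : 0 < ε / (‖f‖ + ‖g‖ + 1) := by positivity
          nlinarith
      _ = ε := by field_simp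
  add_mem' {f g} hf hg := ⟨add_mem hf.1 hg.1, hf.2.add hg.2⟩
  algebraMap_mem' c := ⟨(Hinf X).algebraMap_mem c, by
    change UniformContinuous fun _ : UnitBall X => c
    exact uniformContinuous_const⟩

end Algebras

section AronBerner

variable {X : Type*} [NormedAddCommGroup X] [NormedSpace ℂ X]

/-- The Arens extension of continuous `n`-linear forms, evaluated at `z : Fin n → X**` and seen as a
bounded functional of the form `A`. The variables are extended to `X**` one at a time:
`Ã(z₀, z₁, …, zₙ) = z₀ (x ↦ (A(x, ·, …, ·))~ (z₁, …, zₙ))`. -/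
noncomputable def arens :
    (n : ℕ) → (Fin n → Bidual X) →
      (ContinuousMultilinearMap ℂ (fun _ : Fin n => X) ℂ →L[ℂ] ℂ)
  | 0, _ => (continuousMultilinearCurryFin0 ℂ X ℂ).toContinuousLinearEquiv.toContinuousLinearMap
  | n + 1, z =>
      (z 0).comp
        ((ContinuousLinearMap.compL ℂ X
            (ContinuousMultilinearMap ℂ (fun _ : Fin n => X) ℂ) ℂ (arens n (Fin.tail z))).comp
          (continuousMultilinearCurryLeftEquiv ℂ
            (fun _ : Fin (n + 1) => X) ℂ).toContinuousLinearEquiv.toContinuousLinearMap)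

theorem arens_zero (z : Fin 0 → Bidual X)
    (A : ContinuousMultilinearMap ℂ (fun _ : Fin 0 => X) ℂ) : arens 0 z A = A 0 := rfl

theorem arens_succ (n : ℕ) (z : Fin (n + 1) → Bidual X)
    (A : ContinuousMultilinearMap ℂ (fun _ : Fin (n + 1) => X) ℂ) :
    arens (n + 1) z A = z 0 ((arens n (Fin.tail z)).comp A.curryLeft) := rfl

variable (X) in
/-- A continuous polynomial `P` on `X`, i.e. an element of `P(X)`: a finite sum of continuous
homogeneous polynomials `x ↦ A_k(x, …, x)`, given by the associated symmetric continuous `k`-linear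
forms `A_k` (which the function `P` determines). -/
structure ContPoly where
  deg : ℕ
  form : (k : ℕ) → ContinuousMultilinearMap ℂ (fun _ : Fin k => X) ℂ
  symm : ∀ (k : ℕ) (σ : Equiv.Perm (Fin k)) (v : Fin k → X), form k (v ∘ σ) = form k v

/-- The value `P(x)`. -/
noncomputable def ContPoly.eval (P : ContPoly X) (x : X) : ℂ :=
  ∑ k ∈ Finset.range (P.deg + 1), P.form k (fun _ => x)

/-- The Aron–Berner extension `P̃` of `P`, on `X**`. -/
noncomputable def ContPoly.aronBerner (P : ContPoly X) (z : Bidual X) : ℂ :=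
  ∑ k ∈ Finset.range (P.deg + 1), arens k (fun _ => z) (P.form k)

/-- The symmetric `k`-linear form `D^k g(0) / k!` of the `k`-th Taylor polynomial of `g` at `0`. -/
noncomputable def taylorForm (g : UnitBall X → ℂ) (k : ℕ) :
    ContinuousMultilinearMap ℂ (fun _ : Fin k => X) ℂ :=
  ((k.factorial : ℂ)⁻¹) • iteratedFDeriv ℂ k (zeroExt g) 0

/-- The Aron–Berner extension of a bounded holomorphic `g` to the open unit ball of `X**`: the sum of
the Aron–Berner extensions of the Taylor polynomials of `g` at `0`. -/
noncomputable def aronBernerOpen (g : UnitBall X → ℂ) (z : Bidual X) : ℂ :=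
  ∑' k : ℕ, arens k (fun _ => z) (taylorForm g k)

/-- For `g ∈ A_u(B)`: the value `g̃(z)` at `z` in the closed unit ball of `X**` of the extension
of `g`, continuous up to the boundary, of the function `aronBernerOpen g` on the open ball. -/
noncomputable def aronBernerClosed (g : UnitBall X → ℂ) (z : Bidual X) : ℂ :=
  extendFrom (Metric.ball (0 : Bidual X) 1) (aronBernerOpen g) z

end AronBerner

section ClusterFiber

variable {X : Type*} [NormedAddCommGroup X] [NormedSpace ℂ X]

/-- The point evaluation `δ_x ∈ M_{H(B)}` for `x ∈ B`. The spectrum `M_{H(B)}` is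
`WeakDual.characterSpace ℂ H`, with the weak-star (Gelfand) topology. -/
noncomputable def pointEval (H : Subalgebra ℂ (UnitBall X →ᵇ ℂ)) (x : UnitBall X) :
    WeakDual.characterSpace ℂ H :=
  ⟨StrongDual.toWeakDual
      ((BoundedContinuousFunction.evalCLM ℂ x).comp H.toSubmodule.subtypeL), by
    refine ⟨fun h => ?_, fun f g => rfl⟩
    have := congrArg (fun φ : WeakDual ℂ H => φ 1) h
    exact one_ne_zero (α := ℂ) this⟩

set_option linter.unusedSectionVars false in
theorem pointEval_apply (H : Subalgebra ℂ (UnitBall X →ᵇ ℂ)) (x : UnitBall X) (f : H) :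
    pointEval H x f = (f : UnitBall X →ᵇ ℂ) x := rfl

/-- The polynomial cluster set of `f` at `z ∈ X**`: all limits of `f` along nets in `B` (here:
proper filters on `B`) along which `P(x) → P̃(z)` for every continuous polynomial `P` on `X`. -/
def polyClusterSet (f : UnitBall X → ℂ) (z : Bidual X) : Set ℂ :=
  {c | ∃ F : Filter (UnitBall X), F.NeBot ∧
    (∀ P : ContPoly X, Tendsto (fun x : UnitBall X => P.eval (x : X)) F (𝓝 (P.aronBerner z))) ∧
    Tendsto f F (𝓝 c)}

/-- The polynomial fiber of `M_{H(B)}` at `z`: the characters of `H(B)` whose restriction to `A_u(B)`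
is `δ_z : g ↦ g̃(z)`. -/
def polyFiber (H : Subalgebra ℂ (UnitBall X →ᵇ ℂ)) (z : Bidual X) :
    Set (WeakDual.characterSpace ℂ H) :=
  {τ | ∀ g : H, (g : UnitBall X →ᵇ ℂ) ∈ Au X →
    τ g = aronBernerClosed (g : UnitBall X →ᵇ ℂ) z}

end ClusterFiber

end PolyCluster

/-!
The proof rests on two facts about the Aron–Berner extension to the closed ball of `X**`.

*Polynomials see `X**` through `B`* (`exists_filter_tendsto_eval`, after Davie and Gamelin). Let `w`
have norm less than `ρ`. By Goldstine's theorem `w` is the weak-star limit of a filter `U` on the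
`ρ`-ball of `X`. Choose points `x₀, x₁, …` one after the other along `U`. A symmetric form evaluated
at distinct points among them is, in the iterated limit, its Arens extension at `(w, …, w)`. In the
expansion of a homogeneous polynomial at the mean of `m` such points, the proportion of terms with a
repeated index tends to `0` as `m → ∞`, so the polynomial at the mean tends to its Aron–Berner
extension at `w`. The mean stays in the `ρ`-ball, hence uniform estimates between polynomials on a
ball of `X` persist for their extensions (`norm_aronBerner_sub_le`).

*Polynomials are dense in `A_u(B)`* (`exists_contPoly_norm_sub_le`): for `g ∈ A_u(B)` the dilations
`x ↦ g (r x)` tend to `g` uniformly as `r → 1`, and by Cauchy's estimates on complex lines each of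
them is the uniform sum of its Taylor series.

Together they show that the extension of `g ∈ A_u(B)` is on the open ball of `X**` a uniform limit
of extensions of polynomials, which are continuous on `X**`. So the limits that define
`aronBernerClosed g` exist (`tendsto_aronBernerOpen`), `aronBernerClosed` agrees with the
Aron–Berner extension on polynomials, and convergence of a filter on `B` to `z` on all polynomials
is convergence to `z` on all of `A_u(B)` (`tendsto_aronBernerClosed`).

A cluster value of `f` at `z` is then `τ f` for a limit `τ` in the compact spectrum of an
ultrafilter of point evaluations, and `τ` lies in the fiber over `z`. Conversely, a character `τ` in
the fiber is, by density of `B`, a limit of point evaluations, along which the polynomials tend to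
their extensions at `z` and `f` tends to `τ f`.
-/

namespace PolyCluster

variable {X : Type*} [NormedAddCommGroup X] [NormedSpace ℂ X]

/-! ### Goldstine's theorem -/

theorem convex_image_weakBilin {Y Z : Type*} [NormedAddCommGroup Y]
    [NormedSpace ℂ Y] [NormedAddCommGroup Z] [NormedSpace ℂ Z]
    (J : Z →ₗ[ℂ] WeakBilin (topDualPairing ℂ Y)) {C : Set Z} (hC : Convex ℝ C) :
    Convex ℝ (J '' C) := by
  have hsmul : ∀ (a : ℝ) (x : Z), J (a • x) = a • J x := fun a x => by
    rw [← Complex.coe_smul a x, map_smul]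
    exact (algebra_compatible_smul ℂ a (J x)).symm
  rintro _ ⟨x, hx, rfl⟩ _ ⟨y, hy, rfl⟩ a b ha hb hab
  exact ⟨a • x + b • y, hC hx hy ha hb hab, by rw [map_add, hsmul, hsmul]⟩

/-- Hahn–Banach separation in the weak-star topology: the separating functionals are the
evaluations at points of the predual. -/
theorem exists_re_lt_of_notMem_closure {Y : Type*} [NormedAddCommGroup Y] [NormedSpace ℂ Y]
    {S : Set (WeakBilin (topDualPairing ℂ Y))} (hS : Convex ℝ S)
    {w : WeakBilin (topDualPairing ℂ Y)} (hw : w ∉ closure S) :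
    ∃ (φ : Y) (u : ℝ), (∀ v ∈ S, (topDualPairing ℂ Y v φ).re < u) ∧
      u < (topDualPairing ℂ Y w φ).re := by
  have := IsScalarTower.continuousSMul (M := ℝ) (α := WeakBilin (topDualPairing ℂ Y)) ℂ
  obtain ⟨F, u, hF, hu⟩ :=
    RCLike.geometric_hahn_banach_closed_point (𝕜 := ℂ) hS.closure isClosed_closure hw
  obtain ⟨φ, rfl⟩ := LinearMap.dualEmbedding_surjective (topDualPairing ℂ Y) F
  exact ⟨φ, u, fun v hv => hF _ (subset_closure hv), hu⟩

/-- **Goldstine's theorem**, in filter form: a bidual element of norm `< ρ` is the weak-star limit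
of a filter on the open `ρ`-ball of `X`. -/
theorem exists_filter_tendsto_bidual (w : Bidual X) {ρ : ℝ} (hw : ‖w‖ < ρ) :
    ∃ U : Filter X, U.NeBot ∧ (∀ᶠ x in U, ‖x‖ < ρ) ∧
      ∀ φ : StrongDual ℂ X, Tendsto φ U (𝓝 (w φ)) := by
  have hρ : 0 < ρ := (norm_nonneg w).trans_lt hw
  let J : X →ₗ[ℂ] WeakBilin (topDualPairing ℂ (StrongDual ℂ X)) :=
    (NormedSpace.inclusionInDoubleDual ℂ X).toLinearMap
  let w' : WeakBilin (topDualPairing ℂ (StrongDual ℂ X)) := w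
  have hcl : w' ∈ closure (J '' Metric.ball 0 ρ) := by
    by_contra hn
    obtain ⟨φ, u, hF, hu⟩ := exists_re_lt_of_notMem_closure
      (convex_image_weakBilin J (convex_ball (0 : X) ρ)) hn
    have hball : ∀ x : X, ‖x‖ < ρ → (φ x).re < u := fun x hx =>
      hF (J x) ⟨x, by simpa using hx, rfl⟩
    have hw' : u < (w φ).re := hu
    -- `Re φ < u` on the `ρ`-ball bounds the norm of `φ`, after rotating `φ x` to the positive axis.
    have hnorm : ‖φ‖ ≤ u / ρ := by
      by_contra! hlt
      obtain ⟨x, hx, hux⟩ := φ.exists_lt_apply_of_lt_opNorm hlt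
      obtain ⟨c, hc, hcx⟩ := RCLike.exists_norm_eq_mul_self (φ x)
      have := hball ((ρ * c : ℂ) • x) (by
        rw [norm_smul, norm_mul, hc]; simpa [abs_of_pos hρ] using by nlinarith)
      have e : φ ((ρ * c : ℂ) • x) = ((ρ * ‖φ x‖ : ℝ) : ℂ) := by
        rw [map_smul, smul_eq_mul, mul_assoc, ← hcx]; push_cast; rfl
      rw [e, Complex.ofReal_re] at this
      rw [div_lt_iff₀ hρ] at hux
      linarith
    have h1 : (w φ).re ≤ ‖w‖ * ‖φ‖ := (Complex.re_le_norm _).trans (w.le_opNorm φ)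
    have h2 : ‖w‖ * ‖φ‖ ≤ ρ * (u / ρ) := by gcongr
    rw [mul_div_cancel₀ _ hρ.ne'] at h2
    linarith
  refine ⟨map Subtype.val (comap (fun x : Metric.ball (0 : X) ρ => J x)
    (𝓝 (w'))), ?_, ?_, fun φ => ?_⟩
  · refine Filter.NeBot.map (comap_neBot fun t ht => ?_) _
    obtain ⟨_, hy, x, hx, rfl⟩ := mem_closure_iff_nhds.1 hcl t ht
    exact ⟨⟨x, hx⟩, hy⟩
  · exact eventually_map.2 (Eventually.of_forall fun x => mem_ball_zero_iff.1 x.2)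
  · refine tendsto_map'_iff.2 ?_
    have h1 := (WeakBilin.eval_continuous (topDualPairing ℂ (StrongDual ℂ X)) φ).tendsto w'
    exact h1.comp tendsto_comap

/-! ### Iterated limits of symmetric forms -/

/-- The `m`-fold iterated product of a filter: a property holds eventually along it if for
eventually all `x₀`, for eventually all `x₁`, …, for eventually all `xₘ₋₁`, it holds for
`(x₀, …, xₘ₋₁)`. Limits along it are iterated limits. -/
noncomputable def iterFilter {α : Type*} (U : Filter α) : (m : ℕ) → Filter (Fin m → α)
  | 0 => pure Fin.elim0
  | m + 1 => U.bind fun x => (iterFilter U m).map (Fin.cons x)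

theorem eventually_iterFilter_succ {α : Type*} {U : Filter α} {m : ℕ}
    {p : (Fin (m + 1) → α) → Prop} :
    (∀ᶠ v in iterFilter U (m + 1), p v) ↔
      ∀ᶠ x in U, ∀ᶠ v in iterFilter U m, p (Fin.cons x v) := Iff.rfl

theorem iterFilter_neBot {α : Type*} (U : Filter α) [hU : U.NeBot] (m : ℕ) :
    (iterFilter U m).NeBot := by
  induction m with
  | zero => exact pure_neBot
  | succ m ih =>
    refine ⟨fun h => ?_⟩
    rw [← eventually_false_iff_eq_bot, eventually_iterFilter_succ] at h
    simp only [eventually_const] at h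

theorem eventually_iterFilter_forall {α : Type*} {U : Filter α} {p : α → Prop}
    (h : ∀ᶠ x in U, p x) (m : ℕ) : ∀ᶠ v in iterFilter U m, ∀ i, p (v i) := by
  induction m with
  | zero => exact Eventually.of_forall fun v i => i.elim0
  | succ m ih =>
    rw [eventually_iterFilter_succ]
    filter_upwards [h] with x hx
    filter_upwards [ih] with v hv
    exact Fin.forall_fin_succ.2 ⟨hx, hv⟩

/-- Fixing the first variable of a symmetric form gives a symmetric form. -/
theorem curryLeft_symm {k : ℕ} {A : ContinuousMultilinearMap ℂ (fun _ : Fin (k + 1) => X) ℂ}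
    (hA : ∀ (σ : Equiv.Perm (Fin (k + 1))) (v : Fin (k + 1) → X), A (v ∘ σ) = A v) (x : X)
    (σ : Equiv.Perm (Fin k)) (v : Fin k → X) : A.curryLeft x (v ∘ σ) = A.curryLeft x v := by
  rw [ContinuousMultilinearMap.curryLeft_apply, ContinuousMultilinearMap.curryLeft_apply,
    ← hA (Equiv.Perm.decomposeFin.symm (0, σ)) (Fin.cons x v)]
  congr 1
  funext l
  refine Fin.cases ?_ (fun l => ?_) l <;> simp

/-- A symmetric form, evaluated at distinct entries of a tuple, tends to its Arens extension along
the iterated filter. Symmetry allows the order of the limits to be that of the positions in the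
tuple. -/
theorem tendsto_form_iterFilter {U : Filter X} {w : Bidual X}
    (hU : ∀ φ : StrongDual ℂ X, Tendsto φ U (𝓝 (w φ))) (m : ℕ) :
    ∀ {k : ℕ} (A : ContinuousMultilinearMap ℂ (fun _ : Fin k => X) ℂ),
      (∀ (σ : Equiv.Perm (Fin k)) (v : Fin k → X), A (v ∘ σ) = A v) →
      ∀ i : Fin k → Fin m, Function.Injective i →
        Tendsto (fun v : Fin m → X => A (v ∘ i)) (iterFilter U m)
          (𝓝 (arens k (fun _ => w) A)) := by
  have hzero : ∀ {m : ℕ} (A : ContinuousMultilinearMap ℂ (fun _ : Fin 0 => X) ℂ)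
      (i : Fin 0 → Fin m), Tendsto (fun v : Fin m → X => A (v ∘ i)) (iterFilter U m)
        (𝓝 (arens 0 (fun _ => w) A)) := fun A i => by
    rw [arens_zero]
    exact tendsto_const_nhds.congr fun v => congrArg A (Subsingleton.elim _ _)
  induction m with
  | zero =>
    intro k A _ i _
    cases k with
    | zero => exact hzero A i
    | succ k => exact (i 0).elim0
  | succ m ih =>
    intro k A hA i hi
    cases k with
    | zero => exact hzero A i
    | succ k =>
      by_cases h0 : ∃ j, i j = 0
      · obtain ⟨j, hj⟩ := h0
        -- By symmetry the entry with index `0`, over which the outermost limit is taken, may be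
        -- moved to the first variable of `A`.
        set i₁ : Fin (k + 1) → Fin (m + 1) := i ∘ Equiv.swap 0 j with hi₁
        have hi₁inj : Function.Injective i₁ := hi.comp (Equiv.injective _)
        have hi₁0 : i₁ 0 = 0 := by simp [hi₁, hj]
        have hne : ∀ l : Fin k, i₁ l.succ ≠ 0 := fun l h =>
          Fin.succ_ne_zero l (hi₁inj (h.trans hi₁0.symm))
        let i₂ : Fin k → Fin m := fun l => (i₁ l.succ).pred (hne l)
        have hi₂ : Function.Injective i₂ := fun a b hab =>
          Fin.succ_injective _ (hi₁inj (Fin.pred_inj.1 hab))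
        have hval : ∀ (x : X) (v : Fin m → X),
            A ((Fin.cons x v : Fin (m + 1) → X) ∘ i) = A.curryLeft x (v ∘ i₂) := by
          intro x v
          rw [ContinuousMultilinearMap.curryLeft_apply, ← hA (Equiv.swap 0 j)]
          congr 1
          funext l
          change (Fin.cons x v : Fin (m + 1) → X) (i₁ l) = _
          refine Fin.cases ?_ (fun l => ?_) l
          · rw [hi₁0]; rfl
          · rw [Fin.cons_succ, ← Fin.succ_pred (i₁ l.succ) (hne l), Fin.cons_succ]
            rfl
        rw [arens_succ]
        refine tendsto_nhds.2 fun V hV hmem => ?_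
        refine eventually_iterFilter_succ.2 ?_
        have h1 := (hU ((arens k (Fin.tail fun _ => w)).comp A.curryLeft)).eventually
          (hV.mem_nhds hmem)
        filter_upwards [h1] with x hx
        have h2 := (ih (A.curryLeft x) (curryLeft_symm hA x) i₂ hi₂).eventually
          (hV.mem_nhds hx)
        filter_upwards [h2] with v hv
        rw [← hval] at hv
        exact hv
      · push Not at h0
        refine tendsto_nhds.2 fun V hV hmem => ?_
        refine eventually_iterFilter_succ.2 (Eventually.of_forall fun x => ?_)
        have hi₂ : Function.Injective fun l => (i l).pred (h0 l) := fun a b hab =>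
          hi (Fin.pred_inj.1 hab)
        filter_upwards [(ih A hA _ hi₂).eventually (hV.mem_nhds hmem)] with v hv
        have e : (Fin.cons x v : Fin (m + 1) → X) ∘ i = v ∘ fun l => (i l).pred (h0 l) := by
          funext l
          conv_lhs => rw [Function.comp_apply, ← Fin.succ_pred (i l) (h0 l), Fin.cons_succ]
          rfl
        change A ((Fin.cons x v : Fin (m + 1) → X) ∘ i) ∈ V
        rw [e]
        exact hv

/-! ### Aron–Berner extensions as limits of means -/

/-- A large sample without replacement is almost one with replacement: the proportion of injective
maps among all maps `Fin k → Fin m` tends to `1`. -/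
theorem tendsto_descFactorial_div_pow (k : ℕ) :
    Tendsto (fun m : ℕ => (m.descFactorial k : ℝ) / (m : ℝ) ^ k) atTop (𝓝 1) := by
  have h : Tendsto (fun m : ℕ => (1 - (k : ℝ) / m) ^ k) atTop (𝓝 1) := by
    simpa using ((tendsto_const_div_atTop_nhds_zero_nat (k : ℝ)).const_sub 1).pow k
  refine tendsto_of_tendsto_of_tendsto_of_le_of_le' h tendsto_const_nhds ?_ ?_
  · filter_upwards [eventually_ge_atTop (k + 1)] with m hm
    have hm0 : (0 : ℝ) < m := by exact_mod_cast (by omega : 0 < m)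
    rw [one_sub_div hm0.ne', div_pow]
    gcongr
    have h1 := Nat.pow_sub_le_descFactorial m k
    have h2 : ((m + 1 - k : ℕ) : ℝ) ^ k ≤ m.descFactorial k := by exact_mod_cast h1
    refine le_trans ?_ h2
    have h3 : (k : ℝ) ≤ m := by exact_mod_cast (by omega : k ≤ m)
    refine pow_le_pow_left₀ (by linarith) ?_ k
    rw [Nat.cast_sub (by omega)]
    push_cast
    linarith
  · filter_upwards [eventually_gt_atTop 0] with m hm
    have hm0 : (0 : ℝ) < m := by exact_mod_cast hm
    rw [div_le_one (by positivity)]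
    exact_mod_cast Nat.descFactorial_le_pow m k

theorem norm_sum_le_of_injective {k m : ℕ} (F : (Fin k → Fin m) → ℂ) {C ε : ℝ} (hε : 0 ≤ ε)
    (hC : ∀ i, ‖F i‖ ≤ C) (hinj : ∀ i, Function.Injective i → ‖F i‖ ≤ ε) :
    ‖∑ i, F i‖ ≤ (m : ℝ) ^ k * ε + ((m : ℝ) ^ k - m.descFactorial k) * C := by
  classical
  have hcard : (Finset.univ.filter fun i : Fin k → Fin m => Function.Injective i).card =
      m.descFactorial k := by
    have h := Fintype.card_embedding_eq (α := Fin k) (β := Fin m)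
    rw [Fintype.card_fin, Fintype.card_fin] at h
    rw [← h, ← Fintype.card_subtype]
    exact Fintype.card_congr (Equiv.subtypeInjectiveEquivEmbedding _ _)
  have hpt : ∀ i, ‖F i‖ ≤ ε + (1 - if Function.Injective i then 1 else 0) * C := fun i => by
    split_ifs with hi
    · simpa using hinj i hi
    · have := hC i
      linarith
  calc ‖∑ i, F i‖ ≤ ∑ i : Fin k → Fin m,
        (ε + (1 - if Function.Injective i then 1 else 0) * C) :=
        (norm_sum_le _ _).trans (Finset.sum_le_sum fun i _ => hpt i)
    _ = (m : ℝ) ^ k * ε + ((m : ℝ) ^ k - m.descFactorial k) * C := by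
        rw [Finset.sum_add_distrib, ← Finset.sum_mul, Finset.sum_sub_distrib, Finset.sum_boole,
          hcard]
        simp

/-- The filter of the means of `m + 1` points chosen one after the other along `U`, as `m → ∞`;
`m + 1` so that no mean is empty. -/
noncomputable def meanFilter (U : Filter X) : Filter X :=
  (atTop : Filter ℕ).bind fun m =>
    (iterFilter U (m + 1)).map fun v => ((m + 1 : ℕ) : ℂ)⁻¹ • ∑ l, v l

theorem eventually_meanFilter {U : Filter X} {p : X → Prop} :
    (∀ᶠ y in meanFilter U, p y) ↔ ∀ᶠ m : ℕ in atTop, ∀ᶠ v in iterFilter U (m + 1),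
      p (((m + 1 : ℕ) : ℂ)⁻¹ • ∑ l, v l) := Iff.rfl

theorem meanFilter_neBot (U : Filter X) [U.NeBot] : (meanFilter U).NeBot := by
  refine ⟨fun h => ?_⟩
  rw [← eventually_false_iff_eq_bot, eventually_meanFilter] at h
  obtain ⟨m, hm⟩ := h.exists
  exact (iterFilter_neBot U (m + 1)).ne (eventually_false_iff_eq_bot.1 hm)

theorem eventually_meanFilter_norm_lt {U : Filter X} {ρ : ℝ} (h : ∀ᶠ x in U, ‖x‖ < ρ) :
    ∀ᶠ y in meanFilter U, ‖y‖ < ρ := by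
  refine eventually_meanFilter.2 (Eventually.of_forall fun m => ?_)
  filter_upwards [eventually_iterFilter_forall h (m + 1)] with v hv
  have hm : (0 : ℝ) < (m + 1 : ℕ) := by positivity
  rw [norm_smul, norm_inv, Complex.norm_natCast, inv_mul_lt_iff₀ hm]
  calc ‖∑ l, v l‖ ≤ ∑ l, ‖v l‖ := norm_sum_le _ _
    _ < ∑ _l : Fin (m + 1), ρ :=
        Finset.sum_lt_sum_of_nonempty Finset.univ_nonempty fun l _ => hv l
    _ = (m + 1 : ℕ) * ρ := by simp

/-- Along means of many independent points a homogeneous polynomial tends to the value of its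
Aron–Berner extension at the weak-star limit: in the expansion of the polynomial at the mean, almost
all terms have distinct indices. -/
theorem tendsto_form_meanFilter {U : Filter X} {w : Bidual X} {ρ : ℝ}
    (hball : ∀ᶠ x in U, ‖x‖ < ρ) (hU : ∀ φ : StrongDual ℂ X, Tendsto φ U (𝓝 (w φ))) {k : ℕ}
    (A : ContinuousMultilinearMap ℂ (fun _ : Fin k => X) ℂ)
    (hA : ∀ (σ : Equiv.Perm (Fin k)) (v : Fin k → X), A (v ∘ σ) = A v) :
    Tendsto (fun y => A fun _ => y) (meanFilter U) (𝓝 (arens k (fun _ => w) A)) := by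
  set L := arens k (fun _ => w) A
  rw [Metric.tendsto_nhds]
  intro ε hε
  set C := ‖A‖ * ρ ^ k + ‖L‖ with hCdef
  have hlim : Tendsto (fun m : ℕ => ε / 2 +
      (1 - ((m + 1).descFactorial k : ℝ) / ((m + 1 : ℕ) : ℝ) ^ k) * C) atTop (𝓝 (ε / 2)) := by
    have h := (tendsto_descFactorial_div_pow k).comp (tendsto_add_atTop_nat 1)
    simpa using ((h.const_sub 1).mul_const C).const_add (ε / 2)
  refine eventually_meanFilter.2 ?_
  filter_upwards [hlim.eventually_lt_const (half_lt_self hε)] with m hm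
  have hdist : ∀ᶠ v in iterFilter U (m + 1), ∀ i : Fin k → Fin (m + 1), Function.Injective i →
      ‖A (v ∘ i) - L‖ < ε / 2 := by
    refine eventually_all.2 fun i => ?_
    by_cases hi : Function.Injective i
    · have := (Metric.tendsto_nhds.1 (tendsto_form_iterFilter hU (m + 1) A hA i hi)) (ε / 2)
        (half_pos hε)
      filter_upwards [this] with v hv _
      rwa [dist_eq_norm] at hv
    · exact Eventually.of_forall fun v h => (hi h).elim
  filter_upwards [hdist, eventually_iterFilter_forall hball (m + 1)] with v hv hvρ
  have hm0 : (0 : ℝ) < ((m + 1 : ℕ) : ℝ) ^ k := by positivity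
  have hmc : ((m + 1 : ℕ) : ℂ) ^ k ≠ 0 := pow_ne_zero _ (Nat.cast_ne_zero.2 m.succ_ne_zero)
  -- The terms with distinct indices are within `ε / 2` of `L`, the few others within `C`.
  have hexp : A (fun _ => ((m + 1 : ℕ) : ℂ)⁻¹ • ∑ l, v l) - L =
      (((m + 1 : ℕ) : ℂ) ^ k)⁻¹ * ∑ i : Fin k → Fin (m + 1), (A (v ∘ i) - L) := by
    rw [ContinuousMultilinearMap.map_smul_univ, ContinuousMultilinearMap.map_sum,
      Finset.sum_sub_distrib, mul_sub, Finset.prod_const, Finset.card_univ, Fintype.card_fin,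
      inv_pow, smul_eq_mul]
    congr 1
    rw [Finset.sum_const, Finset.card_univ, Fintype.card_fun, Fintype.card_fin, Fintype.card_fin,
      nsmul_eq_mul, Nat.cast_pow, inv_mul_cancel_left₀ hmc]
  have hbound : ∀ i : Fin k → Fin (m + 1), ‖A (v ∘ i) - L‖ ≤ C := fun i => by
    refine (norm_sub_le _ _).trans (add_le_add_left ((A.le_opNorm _).trans ?_) _)
    gcongr
    calc ∏ l, ‖(v ∘ i) l‖ ≤ ∏ _l : Fin k, ρ :=
          Finset.prod_le_prod (fun _ _ => norm_nonneg _) fun l _ => (hvρ (i l)).le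
      _ = ρ ^ k := by simp
  have hsum := norm_sum_le_of_injective (fun i => A (v ∘ i) - L) (half_pos hε).le hbound
    fun i hi => (hv i hi).le
  rw [dist_eq_norm, hexp, norm_mul, norm_inv, norm_pow, Complex.norm_natCast,
    inv_mul_lt_iff₀ hm0]
  refine hsum.trans_lt ?_
  calc _ = ((m + 1 : ℕ) : ℝ) ^ k * (ε / 2 +
        (1 - ((m + 1).descFactorial k : ℝ) / ((m + 1 : ℕ) : ℝ) ^ k) * C) := by
        field_simp
    _ < _ := by gcongr

/-- **Davie–Gamelin**: every point of the open `ρ`-ball of `X**` is the limit, for the topology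
given by the continuous polynomials, of a filter on the open `ρ`-ball of `X`. -/
theorem exists_filter_tendsto_eval (w : Bidual X) {ρ : ℝ} (hw : ‖w‖ < ρ) :
    ∃ G : Filter X, G.NeBot ∧ (∀ᶠ y in G, ‖y‖ < ρ) ∧
      ∀ P : ContPoly X, Tendsto P.eval G (𝓝 (P.aronBerner w)) := by
  obtain ⟨U, hne, hball, hU⟩ := exists_filter_tendsto_bidual w hw
  exact ⟨meanFilter U, meanFilter_neBot U, eventually_meanFilter_norm_lt hball, fun P =>
    tendsto_finsetSum _ fun k _ => tendsto_form_meanFilter hball hU (P.form k) (P.symm k)⟩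

/-- Estimates between polynomials on a ball of `X` pass to their Aron–Berner extensions. -/
theorem norm_aronBerner_sub_le {P Q : ContPoly X} {w : Bidual X} {ρ c : ℝ} (hw : ‖w‖ < ρ)
    (h : ∀ y : X, ‖y‖ < ρ → ‖P.eval y - Q.eval y‖ ≤ c) :
    ‖P.aronBerner w - Q.aronBerner w‖ ≤ c := by
  obtain ⟨G, hne, hball, hG⟩ := exists_filter_tendsto_eval w hw
  exact le_of_tendsto ((hG P).sub (hG Q)).norm (hball.mono h)

/-! ### Taylor series of bounded holomorphic functions -/

/-- The Aron–Berner extension of a homogeneous polynomial has the same bound on the `ρ`-ball of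
`X**` as the polynomial on the `ρ`-ball of `X`; no factor depending on the degree is lost. -/
theorem norm_arens_le {k : ℕ} {A : ContinuousMultilinearMap ℂ (fun _ : Fin k => X) ℂ}
    (hA : ∀ (σ : Equiv.Perm (Fin k)) (v : Fin k → X), A (v ∘ σ) = A v) {w : Bidual X} {ρ c : ℝ}
    (hw : ‖w‖ < ρ) (h : ∀ y : X, ‖y‖ < ρ → ‖A fun _ => y‖ ≤ c) :
    ‖arens k (fun _ => w) A‖ ≤ c := by
  obtain ⟨U, hne, hball, hU⟩ := exists_filter_tendsto_bidual w hw
  have := meanFilter_neBot U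
  exact le_of_tendsto (tendsto_form_meanFilter hball hU A hA).norm
    ((eventually_meanFilter_norm_lt hball).mono h)

theorem continuous_arens (k : ℕ) : Continuous fun z : Fin k → Bidual X => arens k z := by
  induction k with
  | zero => exact continuous_const
  | succ k ih =>
    have htail : Continuous fun z : Fin (k + 1) → Bidual X => Fin.tail z :=
      continuous_pi fun i => continuous_apply i.succ
    exact (continuous_apply 0).clm_comp
      (((ContinuousLinearMap.continuous _).comp (ih.comp htail)).clm_comp continuous_const)

/-- The Aron–Berner extension of a polynomial is norm continuous on `X**`. -/
theorem continuous_aronBerner (P : ContPoly X) : Continuous P.aronBerner := by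
  refine continuous_finsetSum _ fun k _ => ?_
  have hdiag : Continuous fun (z : Bidual X) (_ : Fin k) => z :=
    continuous_pi fun _ => continuous_id
  exact ((continuous_arens k).comp hdiag).clm_apply continuous_const

theorem taylorForm_symm {g : UnitBall X → ℂ} (hg : IsHolo g) (k : ℕ) (σ : Equiv.Perm (Fin k))
    (v : Fin k → X) : taylorForm g k (v ∘ σ) = taylorForm g k v := by
  -- `⊤` is the analytic smoothness exponent `ω`.
  have h := (hg 0 (Metric.mem_ball_self one_pos)).contDiffAt (n := ⊤)
  simp only [taylorForm, smul_apply]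
  rw [h.iteratedFDeriv_comp_perm]

/-- The derivatives of `g` at `0` on the diagonal are those of its restrictions to complex lines. -/
theorem iteratedDeriv_slice {g : UnitBall X → ℂ} (hg : IsHolo g) (x : X) (k : ℕ) :
    iteratedDeriv k (fun t : ℂ => zeroExt g (t • x)) 0 =
      iteratedFDeriv ℂ k (zeroExt g) 0 fun _ => x := by
  let ℓ : ℂ →L[ℂ] X := ContinuousLinearMap.toSpanSingleton ℂ x
  have hopen : IsOpen (ℓ ⁻¹' Metric.ball 0 1) := Metric.isOpen_ball.preimage ℓ.continuous
  have h0 : ℓ 0 ∈ Metric.ball (0 : X) 1 := by simp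
  have h := ℓ.iteratedFDerivWithin_comp_right (i := k) (n := k)
    (hg.contDiffOn Metric.isOpen_ball.uniqueDiffOn) Metric.isOpen_ball.uniqueDiffOn
    hopen.uniqueDiffOn h0 le_rfl
  rw [iteratedFDerivWithin_of_isOpen k hopen h0,
    iteratedFDerivWithin_of_isOpen k Metric.isOpen_ball h0] at h
  have h' := congrArg (fun A => A fun _ => (1 : ℂ)) h
  simp only [ContinuousMultilinearMap.compContinuousLinearMap_apply] at h'
  rw [map_zero] at h'
  have hone : ℓ 1 = x := by simp [ℓ]
  rw [hone] at h'
  exact h'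

theorem differentiableOn_slice {g : UnitBall X → ℂ} (hg : IsHolo g) (x : X) {R : ℝ}
    (hR : R * ‖x‖ < 1) :
    DifferentiableOn ℂ (fun t : ℂ => zeroExt g (t • x)) (Metric.closedBall 0 R) := by
  refine hg.differentiableOn.comp (fun t _ => by fun_prop) fun t ht => ?_
  rw [mem_closedBall_zero_iff] at ht
  rw [mem_ball_zero_iff, norm_smul]
  exact (mul_le_mul_of_nonneg_right ht (norm_nonneg x)).trans_lt hR

theorem taylorForm_apply_const {g : UnitBall X → ℂ} (hg : IsHolo g) (x : X) (k : ℕ) :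
    taylorForm g k (fun _ => x) =
      (k.factorial : ℂ)⁻¹ * iteratedDeriv k (fun t : ℂ => zeroExt g (t • x)) 0 := by
  rw [iteratedDeriv_slice hg]
  rfl

/-- Cauchy's estimate for the Taylor polynomials. -/
theorem norm_taylorForm_le {g : UnitBall X → ℂ} (hg : IsHolo g) {M : ℝ} (hM : ∀ x, ‖g x‖ ≤ M)
    {x : X} (hx : ‖x‖ < 1) (k : ℕ) : ‖taylorForm g k fun _ => x‖ ≤ M := by
  have hd : DiffContOnCl ℂ (fun t : ℂ => zeroExt g (t • x)) (Metric.ball 0 1) := by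
    refine DifferentiableOn.diffContOnCl ?_
    rw [closure_ball _ one_ne_zero]
    exact differentiableOn_slice hg x (by simpa using hx)
  have h := Complex.norm_iteratedDeriv_le_of_forall_mem_sphere_norm_le (C := M) k one_pos hd
    fun t ht => by
      have htx : t • x ∈ Metric.ball (0 : X) 1 := by
        rw [mem_ball_zero_iff, norm_smul, mem_sphere_zero_iff_norm.1 ht, one_mul]
        exact hx
      have := hM ⟨t • x, htx⟩
      rwa [← zeroExt_apply g] at this
  have hk : (0 : ℝ) < k.factorial := by exact_mod_cast k.factorial_pos
  rw [taylorForm_apply_const hg, norm_mul, norm_inv, Complex.norm_natCast, inv_mul_le_iff₀ hk]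
  simpa using h

theorem form_smul_const {k : ℕ} (A : ContinuousMultilinearMap ℂ (fun _ : Fin k => X) ℂ) (r : ℂ)
    (x : X) : (A fun _ => r • x) = r ^ k * A fun _ => x := by
  rw [A.map_smul_univ (fun _ => r) fun _ => x]
  simp

theorem norm_taylorForm_le_pow {g : UnitBall X → ℂ} (hg : IsHolo g) {M : ℝ} (hM : ∀ x, ‖g x‖ ≤ M)
    {ρ : ℝ} (hρ : 0 < ρ) {x : X} (hx : ‖x‖ < ρ) (k : ℕ) :
    ‖taylorForm g k fun _ => x‖ ≤ ρ ^ k * M := by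
  have hρ' : (ρ : ℂ) ≠ 0 := by exact_mod_cast hρ.ne'
  have hx' : ‖(ρ : ℂ)⁻¹ • x‖ < 1 := by
    rw [norm_smul, norm_inv, Complex.norm_real, Real.norm_of_nonneg hρ.le, inv_mul_lt_iff₀ hρ]
    simpa using hx
  have h := form_smul_const (taylorForm g k) (ρ : ℂ) ((ρ : ℂ)⁻¹ • x)
  rw [smul_inv_smul₀ hρ'] at h
  rw [h, norm_mul, norm_pow, Complex.norm_real, Real.norm_of_nonneg hρ.le]
  gcongr
  exact norm_taylorForm_le hg hM hx' k

theorem hasSum_taylorForm {g : UnitBall X → ℂ} (hg : IsHolo g) {x : X} (hx : ‖x‖ < 1) :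
    HasSum (fun k => taylorForm g k fun _ => x) (zeroExt g x) := by
  -- The slice through `x` is holomorphic on a disc larger than the unit disc, so its Taylor series
  -- may be evaluated at `1`.
  obtain ⟨R, hR1, hR⟩ : ∃ R : ℝ, 1 < R ∧ R * ‖x‖ < 1 := by
    refine ⟨2 / (1 + ‖x‖), ?_, ?_⟩
    · rw [lt_div_iff₀ (by positivity)]
      linarith
    · rw [div_mul_eq_mul_div, div_lt_one (by positivity)]
      linarith
  have h := Complex.hasSum_taylorSeries_on_ball
    ((differentiableOn_slice hg x hR).mono Metric.ball_subset_closedBall)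
    (z := 1) (by simpa using hR1)
  simp only [one_smul, sub_zero, one_pow] at h
  refine h.congr_fun fun k => ?_
  rw [taylorForm_apply_const hg, smul_eq_mul]

/-- The Taylor polynomial of degree `n` of `x ↦ g (r x)` at `0`. -/
noncomputable def taylorPoly {g : UnitBall X → ℂ} (hg : IsHolo g) (r : ℂ) (n : ℕ) :
    ContPoly X where
  deg := n
  form k := r ^ k • taylorForm g k
  symm k σ v := by
    simp only [smul_apply]
    rw [taylorForm_symm hg]

theorem taylorPoly_eval {g : UnitBall X → ℂ} (hg : IsHolo g) (r : ℂ) (n : ℕ) (x : X) :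
    (taylorPoly hg r n).eval x = ∑ k ∈ Finset.range (n + 1), taylorForm g k fun _ => r • x :=
  Finset.sum_congr rfl fun _ _ => (form_smul_const _ r x).symm

theorem taylorPoly_one_aronBerner {g : UnitBall X → ℂ} (hg : IsHolo g) (n : ℕ) (w : Bidual X) :
    (taylorPoly hg 1 n).aronBerner w =
      ∑ k ∈ Finset.range (n + 1), arens k (fun _ => w) (taylorForm g k) :=
  Finset.sum_congr rfl fun k _ => by simp [taylorPoly]

/-- On smaller balls the Taylor series at `0` converges uniformly, by comparison with a geometric
series. -/
theorem tendstoUniformlyOn_taylor {g : UnitBall X → ℂ} (hg : IsHolo g) {M : ℝ}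
    (hM : ∀ x, ‖g x‖ ≤ M) {ρ : ℝ} (hρ : 0 < ρ) (hρ1 : ρ < 1) :
    TendstoUniformlyOn
      (fun (n : ℕ) (x : X) => ∑ k ∈ Finset.range (n + 1), taylorForm g k fun _ => x)
      (zeroExt g) atTop (Metric.ball 0 ρ) := by
  have h := tendstoUniformlyOn_tsum_nat
    ((summable_geometric_of_lt_one hρ.le hρ1).mul_right M) (s := Metric.ball (0 : X) ρ)
    fun k x hx => norm_taylorForm_le_pow hg hM hρ (mem_ball_zero_iff.1 hx) k
  have h' := h.congr_right fun x hx =>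
    (hasSum_taylorForm hg ((mem_ball_zero_iff.1 hx).trans hρ1)).tsum_eq
  intro u hu
  exact (tendsto_add_atTop_nat 1).eventually (h' u hu)

/-- The Aron–Berner extension to the open ball does not increase the uniform distance to
polynomials. -/
theorem norm_aronBernerOpen_sub_le {g : UnitBall X → ℂ} (hg : IsHolo g) {M : ℝ}
    (hM : ∀ x, ‖g x‖ ≤ M) {P : ContPoly X} {c : ℝ} (h : ∀ x : UnitBall X, ‖g x - P.eval x‖ ≤ c)
    {w : Bidual X} (hw : ‖w‖ < 1) : ‖aronBernerOpen g w - P.aronBerner w‖ ≤ c := by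
  obtain ⟨ρ, hwρ, hρ1⟩ := exists_between hw
  have hρ : 0 < ρ := (norm_nonneg w).trans_lt hwρ
  have hsum : Summable fun k => arens k (fun _ => w) (taylorForm g k) :=
    ((summable_geometric_of_lt_one hρ.le hρ1).mul_right M).of_norm_bounded fun k =>
      norm_arens_le (taylorForm_symm hg k) hwρ fun y hy => norm_taylorForm_le_pow hg hM hρ hy k
  have hlim : Tendsto (fun n => (taylorPoly hg 1 n).aronBerner w) atTop
      (𝓝 (aronBernerOpen g w)) := by
    simp only [taylorPoly_one_aronBerner]
    exact hsum.hasSum.tendsto_sum_nat.comp (tendsto_add_atTop_nat 1)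
  refine le_of_forall_pos_le_add fun ε hε => le_of_tendsto (hlim.sub_const _).norm ?_
  have hunif := Metric.tendstoUniformlyOn_iff.1 (tendstoUniformlyOn_taylor hg hM hρ hρ1) ε hε
  filter_upwards [hunif] with n hn
  refine norm_aronBerner_sub_le hwρ fun y hy => ?_
  have h1 := hn y (mem_ball_zero_iff.2 hy)
  have h2 := h ⟨y, mem_ball_zero_iff.2 (hy.trans hρ1)⟩
  rw [← zeroExt_apply g] at h2
  rw [dist_comm, dist_eq_norm] at h1
  have h3 := taylorPoly_eval hg 1 n y
  rw [one_smul] at h3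
  rw [← h3] at h1
  calc _ ≤ _ := norm_sub_le_norm_sub_add_norm_sub _ (zeroExt g y) _
    _ ≤ c + ε := by linarith

/-! ### Functions in `A_u(B)` on the closed ball of the bidual -/

theorem norm_unitBall_lt {Y : Type*} [NormedAddCommGroup Y] (x : UnitBall Y) : ‖(x : Y)‖ < 1 :=
  mem_ball_zero_iff.1 x.2

theorem norm_form_sub_le {k : ℕ} (A : ContinuousMultilinearMap ℂ (fun _ : Fin k => X) ℂ) {x y : X}
    (hx : ‖x‖ ≤ 1) (hy : ‖y‖ ≤ 1) :
    ‖(A fun _ => x) - A fun _ => y‖ ≤ ‖A‖ * k * ‖x - y‖ := by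
  refine (A.norm_image_sub_le (fun _ => x) fun _ => y).trans ?_
  rw [Fintype.card_fin]
  have h1 : max ‖(fun _ => x : Fin k → X)‖ ‖(fun _ => y : Fin k → X)‖ ^ (k - 1) ≤ 1 :=
    pow_le_one₀ (by positivity)
      (max_le ((pi_norm_const_le x).trans hx) ((pi_norm_const_le y).trans hy))
  have h2 : ‖(fun _ => x : Fin k → X) - fun _ => y‖ ≤ ‖x - y‖ := pi_norm_const_le (x - y)
  calc _ ≤ ‖A‖ * k * 1 * ‖x - y‖ := by gcongr
    _ = _ := by ring

theorem ContPoly.norm_eval_sub_le (P : ContPoly X) {x y : X} (hx : ‖x‖ ≤ 1) (hy : ‖y‖ ≤ 1) :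
    ‖P.eval x - P.eval y‖ ≤
      (∑ k ∈ Finset.range (P.deg + 1), ‖P.form k‖ * k) * ‖x - y‖ := by
  rw [ContPoly.eval, ContPoly.eval, ← Finset.sum_sub_distrib, Finset.sum_mul]
  exact (norm_sum_le _ _).trans (Finset.sum_le_sum fun k _ => norm_form_sub_le _ hx hy)

theorem ContPoly.uniformContinuous_eval (P : ContPoly X) :
    UniformContinuous fun x : UnitBall X => P.eval x := by
  have hK : 0 ≤ ∑ k ∈ Finset.range (P.deg + 1), ‖P.form k‖ * k :=
    Finset.sum_nonneg fun _ _ => by positivity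
  refine (LipschitzWith.of_dist_le_mul (K := ⟨_, hK⟩) fun x y => ?_).uniformContinuous
  rw [dist_eq_norm, Subtype.dist_eq, dist_eq_norm]
  exact P.norm_eval_sub_le (norm_unitBall_lt x).le (norm_unitBall_lt y).le

theorem ContPoly.norm_eval_le (P : ContPoly X) {x : X} (hx : ‖x‖ ≤ 1) :
    ‖P.eval x‖ ≤ ‖P.eval 0‖ + ∑ k ∈ Finset.range (P.deg + 1), ‖P.form k‖ * k := by
  have h := P.norm_eval_sub_le hx (y := 0) (by simp)
  have hK : 0 ≤ ∑ k ∈ Finset.range (P.deg + 1), ‖P.form k‖ * k :=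
    Finset.sum_nonneg fun _ _ => by positivity
  rw [sub_zero] at h
  have h2 := mul_le_of_le_one_right hK hx
  have h3 := norm_sub_norm_le (P.eval x) (P.eval 0)
  linarith

theorem ContPoly.analyticOnNhd_eval (P : ContPoly X) (s : Set X) : AnalyticOnNhd ℂ P.eval s := by
  refine Finset.analyticOnNhd_fun_sum _ fun k _ => ?_
  let D : X →L[ℂ] (Fin k → X) := ContinuousLinearMap.pi fun _ => ContinuousLinearMap.id ℂ X
  exact (P.form k).analyticOnNhd.comp (D.analyticOnNhd s) (Set.mapsTo_univ _ _)

/-- The restriction of a continuous polynomial to the unit ball, as a bounded function. -/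
noncomputable def ContPoly.toBall (P : ContPoly X) : UnitBall X →ᵇ ℂ :=
  BoundedContinuousFunction.ofNormedAddCommGroup (fun x : UnitBall X => P.eval x)
    P.uniformContinuous_eval.continuous _ fun x => P.norm_eval_le (norm_unitBall_lt x).le

theorem ContPoly.toBall_apply (P : ContPoly X) (x : UnitBall X) : P.toBall x = P.eval x := rfl

theorem ContPoly.toBall_mem_Au (P : ContPoly X) : P.toBall ∈ Au X :=
  ⟨isHolo_of_eq (P.analyticOnNhd_eval _) fun _ => rfl, P.uniformContinuous_eval⟩

/-- The polynomials are uniformly dense in `A_u(B)`. -/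
theorem exists_contPoly_norm_sub_le {g : UnitBall X →ᵇ ℂ} (hg : g ∈ Au X) {ε : ℝ} (hε : 0 < ε) :
    ∃ P : ContPoly X, ∀ x : UnitBall X, ‖g x - P.eval x‖ ≤ ε := by
  have hholo : IsHolo (g : UnitBall X → ℂ) := hg.1
  obtain ⟨δ, hδ, hunif⟩ := Metric.uniformContinuous_iff.1 hg.2 (ε / 2) (half_pos hε)
  obtain ⟨r, hr, hr1⟩ : ∃ r, max 0 (1 - δ) < r ∧ r < 1 :=
    exists_between (max_lt one_pos (by linarith))
  have hr0 : 0 < r := (le_max_left _ _).trans_lt hr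
  have hrδ : 1 - δ < r := (le_max_right _ _).trans_lt hr
  have hT := Metric.tendstoUniformlyOn_iff.1
    (tendstoUniformlyOn_taylor hholo g.norm_coe_le_norm hr0 hr1) (ε / 2) (half_pos hε)
  obtain ⟨n, hn⟩ := hT.exists
  refine ⟨taylorPoly hholo r n, fun x => ?_⟩
  have hx := norm_unitBall_lt x
  have hrx : ‖(r : ℂ) • (x : X)‖ < r := by
    rw [norm_smul, Complex.norm_real, Real.norm_of_nonneg hr0.le]
    nlinarith
  have hxr : dist (x : X) ((r : ℂ) • (x : X)) < δ := by
    have e : (x : X) - (r : ℂ) • (x : X) = ((1 - r : ℝ) : ℂ) • (x : X) := by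
      push_cast
      rw [sub_smul, one_smul]
    rw [dist_eq_norm, e, norm_smul, Complex.norm_real, Real.norm_of_nonneg (by linarith)]
    nlinarith [norm_nonneg (x : X)]
  let y : UnitBall X := ⟨(r : ℂ) • (x : X), mem_ball_zero_iff.2 (hrx.trans hr1)⟩
  have h1 : dist (g x) (g y) < ε / 2 := hunif (a := x) (b := y) hxr
  have h2 := hn (y : X) (mem_ball_zero_iff.2 hrx)
  rw [zeroExt_apply, ← taylorPoly_eval hholo] at h2
  rw [← dist_eq_norm]
  linarith [dist_triangle (g x) (g y) ((taylorPoly hholo r n).eval x)]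

theorem Bidual.norm_lt_one {w : Bidual X} (hw : w ∈ Metric.ball (0 : Bidual X) 1) : ‖w‖ < 1 :=
  (dist_zero_right w).symm.trans_lt hw

theorem nhdsWithin_unitBall_neBot {E : Type*} [NormedAddCommGroup E] [NormedSpace ℂ E] {z : E}
    (hz : z ∈ Metric.closedBall (0 : E) 1) : (𝓝[Metric.ball 0 1] z).NeBot := by
  rw [← mem_closure_iff_nhdsWithin_neBot, closure_ball _ one_ne_zero]
  exact hz

/-- The Aron–Berner extension of a function in `A_u(B)` has limits at the points of the closed
ball, being a uniform limit of extensions of polynomials, which are continuous on `X**`. -/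
theorem tendsto_aronBernerOpen {g : UnitBall X →ᵇ ℂ} (hg : g ∈ Au X) {z : Bidual X}
    (hz : z ∈ Metric.closedBall (0 : Bidual X) 1) :
    Tendsto (aronBernerOpen g) (𝓝[Metric.ball 0 1] z) (𝓝 (aronBernerClosed g z)) := by
  have := nhdsWithin_unitBall_neBot (E := Bidual X) hz
  refine tendsto_extendFrom (cauchy_map_iff_exists_tendsto.1 (Metric.cauchy_iff.2
    ⟨inferInstance, fun ε hε => ?_⟩))
  obtain ⟨P, hP⟩ := exists_contPoly_norm_sub_le hg (show 0 < ε / 4 by positivity)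
  have hnear : ∀ᶠ w in 𝓝[Metric.ball 0 1] z, ‖aronBernerOpen g w - P.aronBerner z‖ < ε / 2 := by
    have h1 := ((continuous_aronBerner P).tendsto z).mono_left
      (nhdsWithin_le_nhds (s := Metric.ball 0 1))
    filter_upwards [(Metric.tendsto_nhds.1 h1) (ε / 4) (by positivity),
      self_mem_nhdsWithin] with w hw hwb
    have h2 := norm_aronBernerOpen_sub_le hg.1 g.norm_coe_le_norm hP (Bidual.norm_lt_one hwb)
    rw [dist_eq_norm] at hw
    linarith [norm_sub_le_norm_sub_add_norm_sub (aronBernerOpen g w) (P.aronBerner w)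
      (P.aronBerner z)]
  refine ⟨_, image_mem_map hnear, ?_⟩
  rintro _ ⟨v, hv, rfl⟩ _ ⟨w, hw, rfl⟩
  have hv' : ‖aronBernerOpen g v - P.aronBerner z‖ < ε / 2 := hv
  have hw' : ‖aronBernerOpen g w - P.aronBerner z‖ < ε / 2 := hw
  rw [← dist_eq_norm] at hv' hw'
  linarith [dist_triangle_right (aronBernerOpen g v) (aronBernerOpen g w) (P.aronBerner z)]

theorem norm_aronBernerClosed_sub_le {g : UnitBall X →ᵇ ℂ} (hg : g ∈ Au X) {P : ContPoly X}
    {c : ℝ} (h : ∀ x : UnitBall X, ‖g x - P.eval x‖ ≤ c) {z : Bidual X}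
    (hz : z ∈ Metric.closedBall (0 : Bidual X) 1) :
    ‖aronBernerClosed g z - P.aronBerner z‖ ≤ c := by
  have := nhdsWithin_unitBall_neBot (E := Bidual X) hz
  refine le_of_tendsto ((tendsto_aronBernerOpen hg hz).sub
    (((continuous_aronBerner P).tendsto z).mono_left nhdsWithin_le_nhds)).norm ?_
  filter_upwards [self_mem_nhdsWithin] with w hw
  exact norm_aronBernerOpen_sub_le hg.1 g.norm_coe_le_norm h (Bidual.norm_lt_one hw)

/-- On polynomials the extension through Taylor series agrees with the Aron–Berner extension. -/
theorem aronBernerClosed_toBall (P : ContPoly X) {z : Bidual X}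
    (hz : z ∈ Metric.closedBall (0 : Bidual X) 1) :
    aronBernerClosed P.toBall z = P.aronBerner z := by
  have h := norm_aronBernerClosed_sub_le P.toBall_mem_Au (P := P) (c := 0)
    (fun x => by rw [P.toBall_apply, sub_self, norm_zero]) hz
  exact sub_eq_zero.1 (norm_le_zero_iff.1 h)

/-- Convergence to `z` for the polynomial topology implies convergence of all functions in
`A_u(B)`. -/
theorem tendsto_aronBernerClosed {F : Filter (UnitBall X)} {z : Bidual X}
    (hz : z ∈ Metric.closedBall (0 : Bidual X) 1)
    (hF : ∀ P : ContPoly X, Tendsto (fun x : UnitBall X => P.eval (x : X)) F (𝓝 (P.aronBerner z)))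
    {g : UnitBall X →ᵇ ℂ} (hg : g ∈ Au X) : Tendsto g F (𝓝 (aronBernerClosed g z)) := by
  rw [Metric.tendsto_nhds]
  intro ε hε
  obtain ⟨P, hP⟩ := exists_contPoly_norm_sub_le hg (show 0 < ε / 3 by positivity)
  have hz' := norm_aronBernerClosed_sub_le hg hP hz
  filter_upwards [(Metric.tendsto_nhds.1 (hF P)) (ε / 3) (by positivity)] with x hx
  have hx' := hP x
  rw [← dist_eq_norm] at hz' hx'
  rw [dist_comm] at hz'
  linarith [dist_triangle4 (g x) (P.eval x) (P.aronBerner z) (aronBernerClosed g z)]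

theorem continuous_eval_character {Y : Type*} [NormedAddCommGroup Y]
    (H : Subalgebra ℂ (UnitBall Y →ᵇ ℂ)) (g : H) :
    Continuous fun τ : WeakDual.characterSpace ℂ H => τ g :=
  (WeakDual.eval_continuous g).comp continuous_subtype_val

end PolyCluster

/-! ### The cluster value theorem -/

/-- `H` is a uniform algebra between `A_u(B)` and `H^∞(B)`. If the evaluations at points of `B` are
dense in its spectrum, then the polynomial cluster value theorem holds at every point of the closed
unit ball of `X**`. -/
theorem theorem2p7 {X : Type*} [NormedAddCommGroup X] [NormedSpace ℂ X] [CompleteSpace X]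
    (H : Subalgebra ℂ (PolyCluster.UnitBall X →ᵇ ℂ))
    (hclosed : IsClosed (H : Set (PolyCluster.UnitBall X →ᵇ ℂ)))
    (hAu : PolyCluster.Au X ≤ H) (hHinf : H ≤ PolyCluster.Hinf X)
    (hcorona : DenseRange (PolyCluster.pointEval H))
    (z : PolyCluster.Bidual X) (hz : z ∈ Metric.closedBall (0 : PolyCluster.Bidual X) 1) (f : H) :
    PolyCluster.polyClusterSet (f : PolyCluster.UnitBall X →ᵇ ℂ) z =
      WeakDual.gelfandTransform ℂ H f '' PolyCluster.polyFiber H z := by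
  -- Completeness makes the spectrum of `H` compact, so that ultrafilters on it converge.
  have : CompleteSpace H := hclosed.completeSpace_coe
  ext c
  constructor
  · rintro ⟨F, hne, hF, hc⟩
    let U : Ultrafilter (PolyCluster.UnitBall X) := Ultrafilter.of F
    have hU : (U : Filter _) ≤ F := Ultrafilter.of_le F
    let τ := (U.map (PolyCluster.pointEval H)).lim
    have hτ : Tendsto (PolyCluster.pointEval H) U (𝓝 τ) :=
      (U.map (PolyCluster.pointEval H)).le_nhds_lim
    have hlim : ∀ g : H, Tendsto (g : PolyCluster.UnitBall X →ᵇ ℂ) U (𝓝 (τ g)) := fun g =>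
      ((PolyCluster.continuous_eval_character H g).tendsto τ).comp hτ
    exact ⟨τ, fun g hg => tendsto_nhds_unique (hlim g)
      (PolyCluster.tendsto_aronBernerClosed hz (fun P => (hF P).mono_left hU) hg),
      tendsto_nhds_unique (hlim f) (hc.mono_left hU)⟩
  · rintro ⟨τ, hτ, rfl⟩
    have hlim : ∀ g : H, Tendsto (g : PolyCluster.UnitBall X →ᵇ ℂ)
        (comap (PolyCluster.pointEval H) (𝓝 τ)) (𝓝 (τ g)) := fun g =>
      ((PolyCluster.continuous_eval_character H g).tendsto τ).comp tendsto_comap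
    refine ⟨comap (PolyCluster.pointEval H) (𝓝 τ), ?_, fun P => ?_, hlim f⟩
    · refine comap_neBot fun t ht => ?_
      obtain ⟨_, hx, x, rfl⟩ := mem_closure_iff_nhds.1 (hcorona τ) t ht
      exact ⟨x, hx⟩
    · have h := hlim ⟨P.toBall, hAu P.toBall_mem_Au⟩
      rw [hτ _ P.toBall_mem_Au, PolyCluster.aronBernerClosed_toBall P hz] at h
      exact h
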